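/- Let $A$ be a group and let $A_0$ be a normal subgroup of finite index in $A$. Let $[A,A]$ be the commutator subgroup of $A$, and let $[A,A_0] \le [A,A]$ be the subgroup generated by all commutators $[a,b]$ with $a \in A$ and $b \in A_0$. Then $[A,A_0]$ has finite index in $[A,A]$, and $$\big[[A,A] : [A,A_0]\big] \leq [A:A_0]^{1+\log [A:A_0]},$$ where $[G:H]$ denotes the index of a subgroup $H$ in a group $G$ and $\log$ is the natural logarithm. -/

import Mathlib

open Subgroup
open scoped commutatorElement

/-! Modulo `⁅⊤, A₀⁆` the image `Z` of `A₀` is central of the same index `n`, so it suffices to bound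
the derived subgroup `G'` of a group `G` with a central subgroup `Z` of index `n`. The index of `G'
∩ Z` in `G'` divides `n`, which accounts for the exponent `1`.

The order of `G' ∩ Z` is bounded one prime at a time. Let `S` be the preimage of a Sylow
`p`-subgroup of `G ⧸ Z`, of order `p ^ k`. Transfer to `S` places the `p`-part of `G' ∩ Z` inside
`S'`, and Wiegold's bound gives `|S'| ≤ p ^ (k(k-1)/2)`. As `k ≤ log₂ n`, the square of `|G' ∩ Z|`
divides a power of `n` with exponent at most `log₂ n ≤ 2 log n`. -/

theorem Subgroup.normal_of_le_center {G : Type*} [Group G] {Z : Subgroup G} (hZ : Z ≤ center G) :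
    Z.Normal where
  conj_mem z hz g := by rwa [mem_center_iff.mp (hZ hz) g, mul_inv_cancel_right]

/-- If `x` is central modulo the centre, then `g ↦ ⁅g, x⁆` is a homomorphism. -/
def commutatorHom {G : Type*} [Group G] (x : G) (hx : ∀ g : G, ⁅g, x⁆ ∈ center G) : G →* G where
  toFun g := ⁅g, x⁆
  map_one' := commutatorElement_one_left x
  map_mul' g h := by
    rw [commutatorElement_mul_left_eq_conj_mul, mem_center_iff.mp (hx h) g,
      mul_inv_cancel_right, mem_center_iff.mp (hx h)]

theorem card_commutator_eq_card_mul_card_commutator_quotient {G : Type*} [Group G]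
    (M : Subgroup G) [M.Normal] (hM : M ≤ commutator G) :
    Nat.card (commutator G) = Nat.card M * Nat.card (commutator (G ⧸ M)) := by
  have h : (commutator G).map (QuotientGroup.mk' M) = commutator (G ⧸ M) := by
    rw [map_commutator_eq, QuotientGroup.range_mk', _root_.commutator_def]
  rw [← h, ← relIndex_ker, QuotientGroup.ker_mk', ← relIndex_bot_left, ← relIndex_bot_left,
    relIndex_mul_relIndex _ _ _ bot_le hM]

/-- Wiegold's bound for groups whose central quotient is a `p`-group. -/
theorem exists_card_commutator_eq_prime_pow {p : ℕ} [hp : Fact p.Prime] (k : ℕ) :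
    ∀ {G : Type*} [Group G] (Z : Subgroup G), Z ≤ center G → Z.index = p ^ k →
      ∃ m, Nat.card (commutator G) = p ^ m ∧ 2 * m ≤ k * (k - 1) := by
  induction k with
  | zero =>
    intro G _ Z hZ hk
    rw [pow_zero, index_eq_one] at hk
    refine ⟨0, ?_, by simp⟩
    rw [(commutator_eq_bot_iff_center_eq_top G).mpr (top_le_iff.mp (hk ▸ hZ))]
    simp
  | succ k ih =>
    intro G _ Z hZ hk
    have hZn : Z.Normal := normal_of_le_center hZ
    have hcard : Nat.card (G ⧸ Z) = p ^ (k + 1) := hk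
    have hpos : 0 < p := hp.out.pos
    have : Finite (G ⧸ Z) := Nat.finite_of_card_ne_zero (by rw [hcard]; positivity)
    have hQ : IsPGroup p (G ⧸ Z) := IsPGroup.of_card hcard
    have : Nontrivial (G ⧸ Z) := by
      rw [← Finite.one_lt_card_iff_nontrivial, hcard]
      exact Nat.one_lt_pow (by simp) hp.out.one_lt
    have : Nontrivial (center (G ⧸ Z)) := hQ.center_nontrivial
    have hdvd : p ∣ Nat.card (center (G ⧸ Z)) := by
      obtain ⟨n, hn0, hn⟩ := (hQ.to_subgroup (center (G ⧸ Z))).nontrivial_iff_card.mp this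
      rw [hn]
      exact dvd_pow_self p hn0.ne'
    obtain ⟨⟨y, hy⟩, hyp⟩ := exists_prime_orderOf_dvd_card' p hdvd
    rw [Subgroup.orderOf_mk] at hyp
    obtain ⟨x, rfl⟩ := QuotientGroup.mk_surjective y
    have hxZ (g : G) : ⁅g, x⁆ ∈ Z := by
      rw [← QuotientGroup.eq_one_iff]
      change QuotientGroup.mk' Z ⁅g, x⁆ = 1
      rw [map_commutatorElement, commutatorElement_eq_one_iff_mul_comm]
      exact mem_center_iff.mp hy _
    -- The image of `φ` lies in `Z`, and `φ` kills `W = Z⟨x⟩`, of index `p ^ k`, so its order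
    -- divides `p ^ k`. Modulo this image `x`, hence `W`, is central, and induction applies to the
    -- quotient.
    let φ := commutatorHom x fun g ↦ hZ (hxZ g)
    have hφZ : φ.range ≤ Z := by
      rintro _ ⟨g, rfl⟩
      exact hxZ g
    have hφn : φ.range.Normal := normal_of_le_center (hφZ.trans hZ)
    let W := (zpowers (x : G ⧸ Z)).comap (QuotientGroup.mk' Z)
    have hW : W.index = p ^ k := by
      rw [index_comap_of_surjective _ (QuotientGroup.mk'_surjective Z)]
      have := card_mul_index (zpowers (x : G ⧸ Z))
      rw [Nat.card_zpowers, hyp, hcard, pow_succ'] at this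
      exact Nat.eq_of_mul_eq_mul_left hpos this
    have hZW : Z ≤ W := fun z hz ↦ by
      change (z : G ⧸ Z) ∈ zpowers (x : G ⧸ Z)
      rw [(QuotientGroup.eq_one_iff z).mpr hz]
      exact one_mem _
    have hWφ : W ≤ φ.ker := by
      rintro w ⟨n, hn⟩
      change ⁅w, x⁆ = 1
      have hz : x ^ (-n) * w ∈ Z := by
        rw [← QuotientGroup.eq_one_iff, QuotientGroup.mk_mul, QuotientGroup.mk_zpow]
        have hn : (x : G ⧸ Z) ^ n = w := hn
        rw [← hn, zpow_neg, inv_mul_cancel]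
      have h1 : φ (x ^ n * (x ^ (-n) * w)) = 1 := by
        rw [map_mul, map_zpow]
        have hx : φ x = 1 := commutatorElement_self x
        have hc : φ (x ^ (-n) * w) = 1 :=
          commutatorElement_eq_one_iff_mul_comm.mpr (mem_center_iff.mp (hZ hz) x).symm
        rw [hx, hc, one_zpow, one_mul]
      rwa [zpow_neg, mul_inv_cancel_left] at h1
    obtain ⟨j, hjk, hj⟩ : ∃ j ≤ k, Nat.card φ.range = p ^ j := by
      rw [← Nat.dvd_prime_pow hp.out, ← index_ker, ← hW]
      exact index_dvd_of_le hWφ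
    have hWc : W.map (QuotientGroup.mk' φ.range) ≤ center (G ⧸ φ.range) := by
      rintro _ ⟨w, ⟨n, hn⟩, rfl⟩
      have hn : (x : G ⧸ Z) ^ n = w := hn
      rw [mem_center_iff]
      intro q
      obtain ⟨g, rfl⟩ := QuotientGroup.mk'_surjective _ q
      rw [← commutatorElement_eq_one_iff_mul_comm, ← map_commutatorElement]
      have hz : x ^ (-n) * w ∈ Z := by
        rw [← QuotientGroup.eq_one_iff, QuotientGroup.mk_mul, QuotientGroup.mk_zpow, ← hn, zpow_neg,
          inv_mul_cancel]
      have hxc : QuotientGroup.mk' φ.range x ∈ center _ := by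
        rw [mem_center_iff]
        intro q
        obtain ⟨g, rfl⟩ := QuotientGroup.mk'_surjective _ q
        rw [← commutatorElement_eq_one_iff_mul_comm, ← map_commutatorElement]
        exact (QuotientGroup.eq_one_iff _).mpr ⟨g, rfl⟩
      have hzc : QuotientGroup.mk' φ.range (x ^ (-n) * w) ∈ center _ := by
        rw [mem_center_iff]
        intro q
        obtain ⟨g, rfl⟩ := QuotientGroup.mk'_surjective _ q
        rw [← map_mul, ← map_mul, mem_center_iff.mp (hZ hz)]
      have hwc := mul_mem (zpow_mem hxc n) hzc
      rw [← map_zpow, ← map_mul, zpow_neg, mul_inv_cancel_left] at hwc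
      rw [map_commutatorElement, commutatorElement_eq_one_iff_mul_comm]
      exact mem_center_iff.mp hwc _
    have hWi : (W.map (QuotientGroup.mk' φ.range)).index = p ^ k := by
      rw [index_map_eq _ (QuotientGroup.mk'_surjective _), hW]
      rw [QuotientGroup.ker_mk']
      exact hφZ.trans hZW
    obtain ⟨m, hm, hmk⟩ := ih _ hWc hWi
    refine ⟨j + m, ?_, ?_⟩
    · rw [card_commutator_eq_card_mul_card_commutator_quotient φ.range, hj, hm, pow_add]
      rintro _ ⟨g, rfl⟩
      exact commutator_mem_commutator (mem_top g) (mem_top x)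
    -- For `k = 0` the subtraction in `k - 1` truncates; otherwise `2k + k(k-1) = (k+1)k`.
    · rcases k with _ | k
      · simp_all
      · simp only [Nat.add_sub_cancel] at hmk ⊢
        nlinarith

/-- The transfer to the abelianization of `S` sends a central `z` to the class of `z ^ S.index`, and
kills commutators because its target is abelian. -/
theorem pow_index_mem_commutator {G : Type*} [Group G] (S : Subgroup G) [S.FiniteIndex] {z : G}
    (hz : z ∈ center G) (hzG : z ∈ commutator G) : z ^ S.index ∈ ⁅S, S⁆ := by
  have key (k : ℕ) (g : G) (_ : g⁻¹ * z ^ k * g ∈ S) : g⁻¹ * z ^ k * g = z ^ k := by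
    rw [mul_assoc, ← mem_center_iff.mp (pow_mem hz k) g, inv_mul_cancel_left]
  have h := MonoidHom.transfer_eq_pow (Abelianization.of (G := S)) z key
  have h1 : MonoidHom.transfer (Abelianization.of (G := S)) z = 1 :=
    Abelianization.commutator_subset_ker _ hzG
  rw [h1, eq_comm, ← MonoidHom.mem_ker, Abelianization.ker_of] at h
  rw [← map_subtype_commutator]
  exact ⟨_, h, rfl⟩

/-- A commutator depends only on the cosets of its entries modulo `Z`, so there are finitely many;
Schur's theorem then applies. -/
theorem finite_commutator_of_le_center {G : Type*} [Group G] (Z : Subgroup G) [Z.FiniteIndex]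
    (hZ : Z ≤ center G) : Finite (commutator G) := by
  have : Finite (commutatorSet G) := by
    refine Set.Finite.subset
      (Set.finite_range fun q : (G ⧸ Z) × (G ⧸ Z) ↦ ⁅q.1.out, q.2.out⁆) ?_
    rintro _ ⟨g, h, rfl⟩
    refine ⟨((g : G ⧸ Z), (h : G ⧸ Z)), ?_⟩
    obtain ⟨⟨a, ha⟩, ha'⟩ := QuotientGroup.mk_out_eq_mul Z g
    obtain ⟨⟨b, hb⟩, hb'⟩ := QuotientGroup.mk_out_eq_mul Z h
    have ha := mem_center_iff.mp (hZ ha)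
    have hb := mem_center_iff.mp (hZ hb)
    simp only [ha', hb', commutatorElement_def, mul_inv_rev]
    calc g * a * (h * b) * (a⁻¹ * g⁻¹) * (b⁻¹ * h⁻¹)
        = g * (a * (h * b) * a⁻¹) * (g⁻¹ * b⁻¹) * h⁻¹ := by group
      _ = g * (h * b * a * a⁻¹) * (g⁻¹ * b⁻¹) * h⁻¹ := by rw [ha]
      _ = g * h * (b * g⁻¹) * b⁻¹ * h⁻¹ := by group
      _ = g * h * (g⁻¹ * b) * b⁻¹ * h⁻¹ := by rw [hb]
      _ = g * h * g⁻¹ * h⁻¹ := by group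
  infer_instance

theorem two_mul_factorization_card_commutator_inf_le {G : Type*} [Group G] (Z : Subgroup G)
    [Z.FiniteIndex] (hZ : Z ≤ center G) (p : ℕ) [hp : Fact p.Prime] :
    2 * (Nat.card (commutator G ⊓ Z : Subgroup G)).factorization p ≤
      Z.index.factorization p * (Z.index.factorization p - 1) := by
  have hZn : Z.Normal := normal_of_le_center hZ
  have := finite_commutator_of_le_center Z hZ
  have hKfin : Finite (commutator G ⊓ Z : Subgroup G) :=
    Finite.of_injective _ (inclusion_injective inf_le_left)
  obtain ⟨P⟩ : Nonempty (Sylow p (G ⧸ Z)) := inferInstance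
  let S := (P : Subgroup (G ⧸ Z)).comap (QuotientGroup.mk' Z)
  have hSi : S.index = (P : Subgroup (G ⧸ Z)).index :=
    index_comap_of_surjective _ (QuotientGroup.mk'_surjective Z)
  have : S.FiniteIndex := ⟨hSi ▸ FiniteIndex.index_ne_zero⟩
  have hpS : ¬ p ∣ S.index := hSi ▸ P.not_dvd_index
  have hPcard : Nat.card P = p ^ Z.index.factorization p := P.card_eq_multiplicity
  have hZS : (Z.subgroupOf S).index = p ^ Z.index.factorization p := by
    change Z.relIndex S = _
    nth_rw 1 [← QuotientGroup.ker_mk' Z]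
    rw [relIndex_ker, map_comap_eq_self_of_surjective (QuotientGroup.mk'_surjective Z)]
    exact hPcard
  have hZc : Z.subgroupOf S ≤ center S := fun z hz ↦
    mem_center_iff.mpr fun g ↦ Subtype.ext (mem_center_iff.mp (hZ hz) g)
  obtain ⟨m, hm, hmk⟩ := exists_card_commutator_eq_prime_pow _ _ hZc hZS
  obtain ⟨Q⟩ : Nonempty (Sylow p (commutator G ⊓ Z : Subgroup G)) := inferInstance
  have hQS : (Q : Subgroup (commutator G ⊓ Z : Subgroup G)).map (Subgroup.subtype _) ≤ ⁅S, S⁆ := by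
    rintro _ ⟨z, hzQ, rfl⟩
    have hpow := pow_index_mem_commutator S (hZ z.2.2) z.2.1
    obtain ⟨r, hr⟩ := Q.isPGroup' ⟨z, hzQ⟩
    have hr' : (z : G) ^ p ^ r = 1 := by
      simpa using congrArg (fun q : Q ↦ ((q : (commutator G ⊓ Z : Subgroup G)) : G)) hr
    -- The order of `z` is a power of `p`, prime to `S.index`, so `z` is itself a power of `z ^
    -- S.index`.
    have hco : (orderOf (z : G)).Coprime S.index :=
      Nat.Coprime.coprime_dvd_left (orderOf_dvd_of_pow_eq_one hr')
        (((Nat.Prime.coprime_iff_not_dvd hp.out).mpr hpS).pow_left r)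
    obtain ⟨t, ht⟩ := exists_pow_eq_self_of_coprime hco.symm
    rw [subtype_apply, ← ht]
    exact pow_mem hpow t
  have hdvd := card_dvd_of_le hQS
  rw [card_map_of_injective (subtype_injective _), ← map_subtype_commutator,
    card_map_of_injective (subtype_injective _), hm] at hdvd
  have hQcard : Nat.card (Q : Subgroup (commutator G ⊓ Z : Subgroup G)) = _ :=
    Q.card_eq_multiplicity
  rw [hQcard, Nat.pow_dvd_pow_iff_le_right hp.out.one_lt] at hdvd
  omega

theorem sq_card_commutator_inf_dvd {G : Type*} [Group G] (Z : Subgroup G) [Z.FiniteIndex]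
    (hZ : Z ≤ center G) :
    Nat.card (commutator G ⊓ Z : Subgroup G) ^ 2 ∣ Z.index ^ Nat.log 2 Z.index := by
  have := finite_commutator_of_le_center Z hZ
  have hKfin : Finite (commutator G ⊓ Z : Subgroup G) :=
    Finite.of_injective _ (inclusion_injective inf_le_left)
  have hn : Z.index ≠ 0 := FiniteIndex.index_ne_zero
  rw [← Nat.factorization_prime_le_iff_dvd (pow_ne_zero _ Nat.card_pos.ne') (pow_ne_zero _ hn)]
  intro p hp
  have : Fact p.Prime := ⟨hp⟩
  -- `2 ^ k ≤ p ^ k ≤ n` makes the exponent uniform in `p`.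
  have hlog : Z.index.factorization p ≤ Nat.log 2 Z.index :=
    Nat.le_log_of_pow_le one_lt_two <|
      (Nat.pow_le_pow_left hp.two_le _).trans (Nat.ordProj_le p hn)
  rw [Nat.factorization_pow, Nat.factorization_pow, Finsupp.smul_apply, Finsupp.smul_apply,
    smul_eq_mul, smul_eq_mul, mul_comm (Nat.log _ _)]
  exact (two_mul_factorization_card_commutator_inf_le Z hZ p).trans
    (Nat.mul_le_mul_left _ ((Nat.sub_le _ _).trans hlog))

/-- This holds because `2 log 2 ≥ 1`; the factor `2` is absorbed by the square on `|G' ∩ Z|`. -/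
theorem Real.natLog_two_le_two_mul_log {n : ℕ} (hn : n ≠ 0) :
    (Nat.log 2 n : ℝ) ≤ 2 * Real.log n := by
  have h : (2 : ℝ) ^ Nat.log 2 n ≤ n := by exact_mod_cast Nat.pow_log_le_self 2 hn
  have h1 := Real.log_le_log (by positivity) h
  rw [Real.log_pow] at h1
  nlinarith [Real.log_two_gt_d9, Nat.cast_nonneg (α := ℝ) (Nat.log 2 n)]

theorem card_commutator_le_index_rpow {G : Type*} [Group G] (Z : Subgroup G) [Z.FiniteIndex]
    (hZ : Z ≤ center G) :
    (Nat.card (commutator G) : ℝ) ≤ (Z.index : ℝ) ^ (1 + Real.log (Z.index : ℝ)) := by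
  have hZn : Z.Normal := normal_of_le_center hZ
  have hn : Z.index ≠ 0 := FiniteIndex.index_ne_zero
  have hn1 : (1 : ℝ) ≤ Z.index := by exact_mod_cast Nat.one_le_iff_ne_zero.mpr hn
  have hK : (Nat.card (commutator G ⊓ Z : Subgroup G) : ℝ) ≤
      (Z.index : ℝ) ^ Real.log (Z.index : ℝ) := by
    refine le_of_sq_le_sq ?_ (by positivity)
    calc (Nat.card (commutator G ⊓ Z : Subgroup G) : ℝ) ^ 2
        ≤ (Z.index : ℝ) ^ Nat.log 2 Z.index := by
          exact_mod_cast Nat.le_of_dvd (by positivity) (sq_card_commutator_inf_dvd Z hZ)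
      _ = (Z.index : ℝ) ^ (Nat.log 2 Z.index : ℝ) := (Real.rpow_natCast _ _).symm
      _ ≤ (Z.index : ℝ) ^ (Real.log (Z.index : ℝ) * 2) :=
          Real.rpow_le_rpow_of_exponent_le hn1
            (by linarith [Real.natLog_two_le_two_mul_log hn])
      _ = ((Z.index : ℝ) ^ Real.log (Z.index : ℝ)) ^ 2 := by
          rw [Real.rpow_mul (by positivity)]
          exact_mod_cast Real.rpow_natCast _ 2
  have hrel : (Z.relIndex (commutator G) : ℝ) ≤ Z.index := by
    exact_mod_cast Nat.le_of_dvd (Nat.pos_of_ne_zero hn) (relIndex_dvd_index_of_normal Z _)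
  have hmul : Nat.card (commutator G) =
      Z.relIndex (commutator G) * Nat.card (commutator G ⊓ Z : Subgroup G) := by
    rw [← relIndex_bot_left, ← relIndex_bot_left, mul_comm, ← inf_relIndex_left (commutator G) Z,
      relIndex_mul_relIndex _ _ _ bot_le inf_le_left]
  rw [hmul, Nat.cast_mul, Real.rpow_add (by positivity), Real.rpow_one]
  gcongr

theorem mainTheorem7 {A : Type*} [Group A] (A₀ : Subgroup A) [A₀.Normal] [A₀.FiniteIndex] :
    (⁅(⊤ : Subgroup A), A₀⁆).relIndex ⁅(⊤ : Subgroup A), (⊤ : Subgroup A)⁆ ≠ 0 ∧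
      ((⁅(⊤ : Subgroup A), A₀⁆).relIndex ⁅(⊤ : Subgroup A), (⊤ : Subgroup A)⁆ : ℝ) ≤
        (A₀.index : ℝ) ^ (1 + Real.log (A₀.index : ℝ)) := by
  let π := QuotientGroup.mk' ⁅(⊤ : Subgroup A), A₀⁆
  have hπ : Function.Surjective π := QuotientGroup.mk'_surjective _
  have hker : π.ker = ⁅(⊤ : Subgroup A), A₀⁆ := QuotientGroup.ker_mk' _
  have hindex : (A₀.map π).index = A₀.index :=
    index_map_eq _ hπ (hker.trans_le (commutator_le_right _ _))
  have : (A₀.map π).FiniteIndex := ⟨hindex ▸ FiniteIndex.index_ne_zero⟩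
  have hcenter : A₀.map π ≤ center _ := by
    rw [← commutator_top_left_eq_bot_iff_le_center, ← map_top_of_surjective π hπ,
      ← map_commutator, Subgroup.map_eq_bot_iff, hker]
  have := finite_commutator_of_le_center _ hcenter
  have hrel : (⁅(⊤ : Subgroup A), A₀⁆).relIndex ⁅(⊤ : Subgroup A), (⊤ : Subgroup A)⁆ =
      Nat.card (commutator (A ⧸ ⁅(⊤ : Subgroup A), A₀⁆)) := by
    nth_rw 1 [← hker]
    rw [relIndex_ker, map_commutator, map_top_of_surjective π hπ, _root_.commutator_def]
  rw [hrel, ← hindex]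
  exact ⟨Nat.card_pos.ne', card_commutator_le_index_rpow _ hcenter⟩
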